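/- For an integer $n \ge 1$ and an integer $R \ge 1$, let $C_n([1,R])$ be the circulant graph whose vertices are the elements of $\mathbb{Z}/n\mathbb{Z}$, two distinct vertices $i,j$ being adjacent if and only if $i-j \equiv \pm d \pmod n$ for some $d \in \{1,\dots,R\}$. An edge-coloring of a graph $G$ is called adjacent vertex-distinguishing if it is proper (distinct edges sharing an endpoint have different colors) and, for any two adjacent vertices $u$ and $v$, the set of colors of the edges incident to $u$ differs from the set of colors of the edges incident to $v$. The adjacent vertex-distinguishing chromatic index $\chi'_a(G)$ is the smallest number of colors of such an edge-coloring. Theorem. Let $R \ge 1$ and $$n \ge (R+2)\,2^{1+\lfloor \log_2 R\rfloor}\bigl(R+(R+2)\,2^{\lfloor \log_2 R\rfloor}\bigr) - 2R .$$ If $R \not\equiv 1 \pmod 6$ or $n \equiv 0 \pmod 3$, then $$\chi'_a\bigl(C_n([1,R])\bigr) = 2R+1 = \Delta\bigl(C_n([1,R])\bigr)+1,$$ where $\Delta$ denotes the maximum degree. -/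

import Mathlib

/-- The circulant graph `C_n(S)`: the vertices are the elements of `ℤ/nℤ`, and two distinct
vertices `i`, `j` are adjacent when `i - j` or `j - i` is the residue of an element of `S`. -/
abbrev circulant (n : ℕ) (S : Set ℕ) : SimpleGraph (ZMod n) :=
  SimpleGraph.circulantGraph ((fun d : ℕ => (d : ZMod n)) '' S)

section AVD

variable {V C : Type*} {G : SimpleGraph V}

/-- An edge-coloring is proper if distinct edges with a common end get different colors. -/
def IsProperEdgeColoring (c : G.edgeSet → C) : Prop :=
  ∀ e f : G.edgeSet, e ≠ f → ∀ v : V, v ∈ (e : Sym2 V) → v ∈ (f : Sym2 V) → c e ≠ c f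

/-- The set of colors of the edges incident to `v`. -/
def incidentColors (c : G.edgeSet → C) (v : V) : Set C :=
  {a | ∃ e : G.edgeSet, v ∈ (e : Sym2 V) ∧ c e = a}

/-- An adjacent vertex-distinguishing edge-coloring: a proper edge-coloring for which any two
adjacent vertices have different sets of incident colors. -/
def IsAVDColoring (c : G.edgeSet → C) : Prop :=
  IsProperEdgeColoring c ∧
    ∀ u v : V, G.Adj u v → incidentColors c u ≠ incidentColors c v

end AVD

/-- The adjacent vertex-distinguishing chromatic index `χ'ₐ(G)`: the smallest number of colors of
an AVD-coloring of `G` (`⊤` if no finite number of colors is enough). -/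
noncomputable def avdChromaticIndex {V : Type*} (G : SimpleGraph V) : ℕ∞ :=
  ⨅ k ∈ {k : ℕ | ∃ c : G.edgeSet → Fin k, IsAVDColoring c}, (k : ℕ∞)

/-- A coloring of the pairs `i, j` of integers with `|i - j| ≤ R`, the pair `i, i` standing for the
vertex `i`, that is a total coloring of the graph on `ℤ` joining distinct integers at distance at
most `R`. -/
structure IsStripColoring {C : Type*} (R : ℕ) (c : ℤ → ℤ → C) : Prop where
  symm : ∀ i j, c i j = c j i
  inj : ∀ i j k, |j - i| ≤ (R : ℤ) → |k - i| ≤ (R : ℤ) → c i j = c i k → j = k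
  loop : ∀ i j, |i - j| ≤ (R : ℤ) → c i i = c j j → i = j

namespace IsStripColoring

variable {C : Type*} {R : ℕ} {c : ℤ → ℤ → C}

theorem of_locally (hs : ∀ i j, c i j = c j i)
    (h : ∀ x : ℤ, ∃ c' : ℤ → ℤ → C, IsStripColoring R c' ∧
      ∀ i j, x ≤ i + j → i + j ≤ x + 2 * R → c i j = c' i j) : IsStripColoring R c where
  symm := hs
  inj i j k hj hk e := by
    obtain ⟨c', h', hc⟩ := h (2 * i - R)
    rw [abs_le] at hj hk
    rw [hc i j (by omega) (by omega), hc i k (by omega) (by omega)] at e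
    exact h'.inj i j k (abs_le.2 hj) (abs_le.2 hk) e
  loop i j hij e := by
    obtain ⟨c', h', hc⟩ := h (2 * min i j)
    have hij' := hij
    rw [abs_le] at hij'
    rw [hc i i (by omega) (by omega), hc j j (by omega) (by omega)] at e
    exact h'.loop i j hij e

theorem translate (h : IsStripColoring R c) (m : ℤ) :
    IsStripColoring R fun i j => c (i + m) (j + m) where
  symm i j := h.symm _ _
  inj i j k hj hk e := by
    simpa using h.inj (i + m) (j + m) (k + m) (by simpa using hj) (by simpa using hk) e
  loop i j hij e := by
    simpa using h.loop (i + m) (j + m) (by simpa using hij) e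

theorem comp {D : Type*} (h : IsStripColoring R c) {f : C → D} (hf : Function.Injective f) :
    IsStripColoring R fun i j => f (c i j) where
  symm i j := congrArg f (h.symm i j)
  inj i j k hj hk e := h.inj i j k hj hk (hf e)
  loop i j hij e := h.loop i j hij (hf e)

end IsStripColoring

theorem intCast_zmod_eq_imp {N : ℕ} {x y : ℤ} (h : (x : ZMod N) = (y : ZMod N))
    (h1 : x - y < N) (h2 : y - x < N) : x = y := by
  rw [ZMod.intCast_eq_intCast_iff_dvd_sub] at h
  obtain ⟨k, hk⟩ := h
  have hN : (0 : ℤ) < N := by omega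
  have : k < 1 := by
    by_contra hh
    nlinarith
  have : -1 < k := by
    by_contra hh
    nlinarith
  obtain rfl : k = 0 := by omega
  omega

theorem isStripColoring_add (R : ℕ) :
    IsStripColoring R fun i j => ((i + j : ℤ) : ZMod (2 * R + 1)) where
  symm i j := by rw [add_comm i]
  inj i j k hj hk e := by
    rw [abs_le] at hj hk
    have := intCast_zmod_eq_imp e (by push_cast; omega) (by push_cast; omega)
    omega
  loop i j hij e := by
    rw [abs_le] at hij
    have h2 : ((i - j + (i - j) : ℤ) : ZMod (2 * R + 1)) = 0 := by
      push_cast at e ⊢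
      linear_combination e
    have h3 : ((i - j : ℤ) : ZMod (2 * R + 1)) = ((0 : ℤ) : ZMod (2 * R + 1)) := by
      have hR : (2 * R + 1 : ZMod (2 * R + 1)) = 0 := by
        exact_mod_cast ZMod.natCast_self (2 * R + 1)
      push_cast at h2 ⊢
      linear_combination (-(R : ZMod (2 * R + 1))) * h2 + (i - j : ZMod (2 * R + 1)) * hR
    have := intCast_zmod_eq_imp h3 (by push_cast; omega) (by push_cast; omega)
    omega

/-- `IsTransition R n σ`: some strip coloring is `i + j` mod `2 * R + 1` on the left, and, read from
the origin `n`, the same coloring with the colors permuted by `σ` on the right. -/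
def IsTransition (R n : ℕ) (σ : Equiv.Perm (ZMod (2 * R + 1))) : Prop :=
  ∃ c : ℤ → ℤ → ZMod (2 * R + 1), IsStripColoring R c ∧
    (∀ i j : ℤ, i + j < 2 * R → c i j = ((i + j : ℤ) : ZMod (2 * R + 1))) ∧
    ∀ i j : ℤ, 0 ≤ i + j → c (i + n) (j + n) = σ ((i + j : ℤ) : ZMod (2 * R + 1))

namespace IsTransition

variable {R : ℕ}

theorem addLeft (n : ℕ) : IsTransition R n (Equiv.addLeft (2 * n : ZMod (2 * R + 1))) :=
  ⟨_, isStripColoring_add R, fun _ _ _ => rfl, fun i j _ => by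
    simp only [Equiv.coe_addLeft]
    push_cast
    ring⟩

theorem mul {m n : ℕ} {σ τ : Equiv.Perm (ZMod (2 * R + 1))} (hσ : IsTransition R m σ)
    (hτ : IsTransition R n τ) : IsTransition R (m + n) (σ * τ) := by
  obtain ⟨c, hc, hl, hr⟩ := hσ
  obtain ⟨d, hd, hl', hr'⟩ := hτ
  have hr0 : ∀ i j, 2 * (m : ℤ) ≤ i + j → c i j = σ ((i - m + (j - m) : ℤ) : ZMod (2 * R + 1)) :=
    fun i j h => by simpa using hr (i - m) (j - m) (by omega)
  have agree : ∀ i j, 2 * (m : ℤ) ≤ i + j → i + j < 2 * m + 2 * R →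
      c i j = σ (d (i + -m) (j + -m)) := fun i j h1 h2 => by
    rw [hr0 i j h1, hl' _ _ (by omega)]
    simp [sub_eq_add_neg]
  refine ⟨fun i j => if i + j < 2 * m + R then c i j else σ (d (i + -m) (j + -m)),
    .of_locally (fun i j => ?_) fun x => ?_, fun i j h => ?_, fun i j h => ?_⟩
  · simp only [add_comm j i, hc.symm j i, hd.symm (j + -m)]
  · by_cases hx : x < 2 * m
    · refine ⟨c, hc, fun i j h1 h2 => ?_⟩
      split_ifs with h
      · rfl
      · exact (agree i j (by omega) (by omega)).symm
    · refine ⟨_, (hd.translate (-m)).comp σ.injective, fun i j h1 h2 => ?_⟩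
      split_ifs with h
      · exact agree i j (by omega) (by omega)
      · rfl
  · dsimp only
    split_ifs with h'
    · exact hl i j h
    · rw [← agree i j (by omega) (by omega)]
      exact hl i j h
  · have key : σ (d (i + (m + n : ℕ) + -m) (j + (m + n : ℕ) + -m)) =
        (σ * τ) ((i + j : ℤ) : ZMod (2 * R + 1)) := by
      rw [Equiv.Perm.mul_apply, ← hr' i j h]
      congr 2 <;> push_cast <;> ring
    dsimp only
    split_ifs with h'
    · rw [agree _ _ (by push_cast; omega) (by push_cast at h' ⊢; omega), key]
    · exact key

theorem one_zero : IsTransition R 0 1 :=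
  ⟨_, isStripColoring_add R, fun _ _ _ => rfl, fun i j _ => by simp⟩

theorem pow {n : ℕ} {σ : Equiv.Perm (ZMod (2 * R + 1))} (hσ : IsTransition R n σ) (k : ℕ) :
    IsTransition R (k * n) (σ ^ k) := by
  induction k with
  | zero => simpa using one_zero
  | succ k ih => simpa [add_mul, pow_succ] using ih.mul hσ

theorem mul_one {n : ℕ} (h : IsTransition R n 1) (k : ℕ) : IsTransition R (k * n) 1 := by
  simpa using h.pow k

theorem one_period : IsTransition R (2 * R + 1) 1 := by
  have h := addLeft (R := R) (2 * R + 1)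
  rw [ZMod.natCast_self, mul_zero] at h
  convert h
  ext x
  simp

/-- A transition with the identity permutation closes up to a periodic coloring. -/
theorem exists_periodic {n : ℕ} (h : IsTransition R n 1) (hn : R < n) :
    ∃ c : ℤ → ℤ → ZMod (2 * R + 1), IsStripColoring R c ∧
      ∀ i j, c (i + n) (j + n) = c i j := by
  obtain ⟨c, hc, hl, hr⟩ := h
  set q : ℤ → ℤ := fun s => s / (2 * n) with hq
  have hn0 : (0 : ℤ) < 2 * n := by omega
  have hper : ∀ s k : ℤ, q (s + 2 * n * k) = q s + k := fun s k => by
    simp only [hq]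
    rw [Int.add_mul_ediv_left _ _ hn0.ne']
  set e : ℤ → ℤ → ZMod (2 * R + 1) := fun i j => c (i - n * q (i + j)) (j - n * q (i + j)) with he
  have eper : ∀ k i j : ℤ, e (i + n * k) (j + n * k) = e i j := fun k i j => by
    simp only [he]
    rw [show i + n * k + (j + n * k) = i + j + 2 * n * k by ring, hper]
    congr 1 <;> ring
  refine ⟨e, .of_locally (fun i j => ?_) fun x => ?_, fun i j => by simpa using eper 1 i j⟩
  · simp only [he, add_comm j i]
    exact hc.symm _ _
  · refine ⟨_, hc.translate (-(n * q x)), fun i j h1 h2 => ?_⟩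
    rw [← eper (-q x) i j]
    have hx1 : 0 ≤ x - 2 * n * q x := by
      have := Int.mul_ediv_self_le (x := x) (k := 2 * n) hn0.ne'
      simp only [hq]; linarith
    have hx2 : x - 2 * n * q x < 2 * n := by
      have := Int.lt_mul_ediv_self_add (x := x) hn0
      simp only [hq]; linarith
    set i' := i + n * (-q x) with hi'
    set j' := j + n * (-q x) with hj'
    have hs : i' + j' = i + j - 2 * n * q x := by rw [hi', hj']; ring
    have e1 : i + -(n * q x) = i' := by rw [hi']; ring
    have e2 : j + -(n * q x) = j' := by rw [hj']; ring
    rw [e1, e2]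
    generalize 2 * n * q x = y at *
    by_cases hb : i' + j' < 2 * n
    · have : q (i' + j') = 0 := Int.ediv_eq_zero_of_lt (by omega) hb
      simp only [he, this]
      simp
    · have : q (i' + j') = 1 := by
        have := hper (i' + j' - 2 * n) 1
        rw [show i' + j' - 2 * n + 2 * n * 1 = i' + j' by ring] at this
        rw [this]
        have : q (i' + j' - 2 * n) = 0 := Int.ediv_eq_zero_of_lt (by omega) (by omega)
        omega
      simp only [he, this]
      have h3 := hr (i' - n) (j' - n) (by omega)
      have h4 := hl (i' - n) (j' - n) (by omega)
      simp only [sub_add_cancel, Equiv.Perm.one_apply] at h3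
      rw [_root_.mul_one, h3, h4]

end IsTransition

section Rotation

variable {A : Type*} [AddCommGroup A] [DecidableEq A]

/-- Adding `d` and then exchanging `a` with `a + d`. It fixes `a`. -/
def swapShift (a d : A) : Equiv.Perm A :=
  Equiv.swap a (a + d) * Equiv.addLeft d

theorem swapShift_self (a d : A) : swapShift a d a = a := by
  simp [swapShift, add_comm d a]

theorem swapShift_sub (a d : A) : swapShift a d (a - d) = a + d := by
  simp [swapShift]

theorem swapShift_of_ne {a d x : A} (h1 : x ≠ a) (h2 : x ≠ a - d) :
    swapShift a d x = x + d := by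
  simp only [swapShift, Equiv.Perm.mul_apply, Equiv.coe_addLeft]
  rw [Equiv.swap_apply_of_ne_of_ne, add_comm]
  · rintro h
    exact h2 (by rw [← h]; abel)
  · rintro h
    exact h1 (by rw [add_comm] at h; exact add_right_cancel h)

theorem swapShift_pow_add {a d : A} {m k : ℕ} (hm : addOrderOf d = m) (hk : k + 2 ≤ m) :
    (swapShift a d ^ k) (a + d) = a + (k + 1) • d := by
  induction k with
  | zero => simp
  | succ k ih =>
    rw [pow_succ', Equiv.Perm.mul_apply, ih (by omega), swapShift_of_ne]
    · rw [succ_nsmul _ (k + 1), add_assoc]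
    · intro h
      rw [add_eq_left] at h
      have := addOrderOf_dvd_of_nsmul_eq_zero h
      exact absurd (Nat.le_of_dvd (by omega) this) (by omega)
    · intro h
      have h : (k + 2) • d = 0 := by
        rw [succ_nsmul]
        rw [sub_eq_add_neg, add_right_inj] at h
        rw [h]; abel
      have := addOrderOf_dvd_of_nsmul_eq_zero h
      exact absurd (Nat.le_of_dvd (by omega) this) (by omega)

theorem swapShift_pow_apply_mem {a d x : A} {m : ℕ} (hm : addOrderOf d = m) (h2 : 2 ≤ m)
    (hx : x - a ∈ AddSubgroup.zmultiples d) : (swapShift a d ^ (m - 1)) x = x := by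
  have hfin : IsOfFinAddOrder d := addOrderOf_pos_iff.1 (by omega)
  obtain ⟨j, hj, hjx⟩ : ∃ j < m, x = a + j • d := by
    obtain ⟨j, hj, hjx⟩ := (hfin.mem_zmultiples_iff_mem_range_addOrderOf.1 hx) |> Finset.mem_image.1
    refine ⟨j, by simpa [hm] using hj, ?_⟩
    rw [hjx]; abel
  obtain ⟨p, rfl⟩ : ∃ p, m = p + 2 := ⟨m - 2, by omega⟩
  have base : (swapShift a d ^ (p + 1)) (a + d) = a + d := by
    rw [pow_succ', Equiv.Perm.mul_apply, swapShift_pow_add hm le_rfl]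
    have h : a + (p + 1) • d = a - d := by
      have := addOrderOf_nsmul_eq_zero d
      rw [hm, succ_nsmul] at this
      rw [eq_neg_of_add_eq_zero_left this]; abel
    rw [h, swapShift_sub]
  rcases Nat.eq_zero_or_pos j with rfl | hj0
  · rw [hjx]
    simp only [zero_smul, add_zero]
    exact Function.IsFixedPt.perm_pow (swapShift_self a d) _
  · obtain ⟨k, rfl⟩ : ∃ k, j = k + 1 := ⟨j - 1, by omega⟩
    rw [hjx, ← swapShift_pow_add hm (by omega), ← Equiv.Perm.mul_apply, ← pow_add, add_comm,
      pow_add, Equiv.Perm.mul_apply]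
    simp only [show p + 2 - 1 = p + 1 by omega, base]

theorem swapShift_pow_apply_notMem {a d x : A}
    (hx : x - a ∉ AddSubgroup.zmultiples d) (k : ℕ) : (swapShift a d ^ k) x = x + k • d := by
  induction k with
  | zero => simp
  | succ k ih =>
    have key : ∀ l : ℤ, x + k • d ≠ a + l • d := fun l h => hx <| by
      refine AddSubgroup.mem_zmultiples_iff.2 ⟨l - k, ?_⟩
      rw [sub_smul, natCast_zsmul, sub_eq_sub_iff_add_eq_add, add_comm, ← h]
    rw [pow_succ', Equiv.Perm.mul_apply, ih, swapShift_of_ne, succ_nsmul, add_assoc]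
    · simpa using key 0
    · simpa [sub_eq_add_neg] using key (-1)

theorem swapShift_pow_eq_one {a d : A} {m : ℕ} (hm : addOrderOf d = m) (h2 : 2 ≤ m)
    (hd : AddSubgroup.zmultiples d = ⊤) : swapShift a d ^ (m - 1) = 1 := by
  ext x
  simpa using swapShift_pow_apply_mem hm h2 (a := a) (x := x) (by simp [hd])

end Rotation

theorem two_mul_cancel {R : ℕ} {x y : ℤ}
    (h : ((2 * x : ℤ) : ZMod (2 * R + 1)) = ((2 * y : ℤ) : ZMod (2 * R + 1))) :
    (x : ZMod (2 * R + 1)) = (y : ZMod (2 * R + 1)) := by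
  have hR : (2 * R + 1 : ZMod (2 * R + 1)) = 0 := by
    exact_mod_cast ZMod.natCast_self (2 * R + 1)
  push_cast at h
  linear_combination (-(R : ZMod (2 * R + 1))) * h + (x - y : ZMod (2 * R + 1)) * hR

theorem swap_eq_cases {C : Type*} [DecidableEq C] {a b x y : C} (h : y = Equiv.swap a b x) :
    x = a ∧ y = b ∨ x = b ∧ y = a ∨ x ≠ a ∧ x ≠ b ∧ y = x := by
  by_cases ha : x = a
  · subst ha; simp at h; exact Or.inl ⟨rfl, h⟩
  by_cases hb : x = b
  · subst hb; simp at h; exact Or.inr (Or.inl ⟨rfl, h⟩)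
  · rw [Equiv.swap_apply_of_ne_of_ne ha hb] at h
    exact Or.inr (Or.inr ⟨ha, hb, h⟩)

/-- For even `R`, two colors do not cross the cut at the origin and can be exchanged
on one side of it. -/
theorem isStripColoring_cut {R : ℕ} (hR : Even R) :
    IsStripColoring R fun i j : ℤ =>
      if i + j < 0 then ((i + j : ℤ) : ZMod (2 * R + 1))
      else Equiv.swap ((-R - 2 : ℤ) : ZMod (2 * R + 1)) ((-R - 1 : ℤ) : ZMod (2 * R + 1))
        ((i + j : ℤ) : ZMod (2 * R + 1)) := by
  obtain ⟨r, hr⟩ := hR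
  have std := isStripColoring_add R
  have ea : ((-R - 2 : ℤ) : ZMod (2 * R + 1)) = ((R - 1 : ℤ) : ZMod (2 * R + 1)) := by
    rw [ZMod.intCast_eq_intCast_iff_dvd_sub]
    exact ⟨1, by push_cast; ring⟩
  have eb : ((-R - 1 : ℤ) : ZMod (2 * R + 1)) = ((R : ℤ) : ZMod (2 * R + 1)) := by
    rw [ZMod.intCast_eq_intCast_iff_dvd_sub]
    exact ⟨1, by push_cast; ring⟩
  have main : ∀ s t : ℤ, s < 0 → 0 ≤ t → t - s ≤ 2 * R → (s : ZMod (2 * R + 1)) =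
      Equiv.swap ((-R - 2 : ℤ) : ZMod (2 * R + 1)) ((-R - 1 : ℤ) : ZMod (2 * R + 1)) t →
      (s = -R - 1 ∧ t = R - 1) ∨ (s : ZMod (2 * R + 1)) = t := fun s t hs ht hst e => by
    rcases swap_eq_cases e with ⟨h1, h2⟩ | ⟨h1, h2⟩ | ⟨-, -, h⟩
    · left
      rw [ea] at h1
      exact ⟨intCast_zmod_eq_imp h2 (by push_cast; omega) (by push_cast; omega),
        intCast_zmod_eq_imp h1 (by push_cast; omega) (by push_cast; omega)⟩
    · exfalso
      rw [eb] at h1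
      have h3 := intCast_zmod_eq_imp h1 (by push_cast; omega) (by push_cast; omega)
      have h4 := intCast_zmod_eq_imp h2 (by push_cast; omega) (by push_cast; omega)
      omega
    · exact Or.inr h
  refine ⟨fun i j => by simp only [add_comm], fun i j k hj hk e => ?_, fun i j hij e => ?_⟩
  · have hj' := abs_le.1 hj
    have hk' := abs_le.1 hk
    split_ifs at e with h1 h2 h2
    · exact std.inj i j k hj hk e
    · rcases main _ _ h1 (by omega) (by omega) e with h | h
      · omega
      · exact std.inj i j k hj hk h
    · rcases main _ _ h2 (by omega) (by omega) e.symm with h | h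
      · omega
      · exact std.inj i j k hj hk h.symm
    · exact std.inj i j k hj hk ((Equiv.swap _ _).injective e)
  · have hij' := abs_le.1 hij
    split_ifs at e with h1 h2 h2
    · exact std.loop i j hij e
    · rcases main _ _ h1 (by omega) (by omega) e with h | h
      · omega
      · exact std.loop i j hij h
    · rcases main _ _ h2 (by omega) (by omega) e.symm with h | h
      · omega
      · exact std.loop i j hij h.symm
    · exact std.loop i j hij ((Equiv.swap _ _).injective e)

/-- Colors `0, …, 3` for the pairs with sum `0, …, 3`, given as functions of the sum and of minus
the smaller element, that interpolate between the coloring by sums on the left and its modification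
on the right by the exchange of `0` and `3`. -/
structure IsInterpolation (R : ℕ) (f : ℤ → ℤ → ℤ) : Prop where
  range : ∀ i s, |s - 2 * i| ≤ (R : ℤ) → 0 ≤ s → s < 4 →
    0 ≤ f s (max (-i) (i - s)) ∧ f s (max (-i) (i - s)) ≤ 3 ∧
    f s (max (-i) (i - s)) ≤ 2 * i + R
  left : ∀ i s, |s - 2 * i| ≤ (R : ℤ) → 0 ≤ s → s < 4 →
    (f s (max (-i) (i - s)) = 0 → 2 * i - R ≤ 3) ∧
    (f s (max (-i) (i - s)) = 1 → 2 * i - R ≤ 1) ∧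
    (f s (max (-i) (i - s)) = 2 → 2 * i - R ≤ 2) ∧
    (f s (max (-i) (i - s)) = 3 → 2 * i - R ≤ 0)
  inj : ∀ i s t, |s - 2 * i| ≤ (R : ℤ) → |t - 2 * i| ≤ (R : ℤ) → 0 ≤ s → s < t → t < 4 →
    f s (max (-i) (i - s)) ≠ f t (max (-i) (i - t))
  loop : f 0 0 = 0 ∧ f 2 (-1) = 2 ∨ f 0 0 = 2 ∧ f 2 (-1) = 0

/-- The coloring by sums, interpolated to the same coloring with `0` and `3` exchanged. -/
def interpolate (R : ℕ) (f : ℤ → ℤ → ℤ) (i j : ℤ) : ZMod (2 * R + 1) :=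
  if i + j < 0 then ((i + j : ℤ) : ZMod (2 * R + 1))
  else if i + j < 4 then ((f (i + j) (-min i j) : ℤ) : ZMod (2 * R + 1))
  else Equiv.swap ((0 : ℤ) : ZMod (2 * R + 1)) ((3 : ℤ) : ZMod (2 * R + 1))
    ((i + j : ℤ) : ZMod (2 * R + 1))

theorem isStripColoring_interpolate {R : ℕ} (h3 : 3 ≤ R) {f : ℤ → ℤ → ℤ}
    (hf : IsInterpolation R f) : IsStripColoring R (interpolate R f) := by
  have std := isStripColoring_add R
  have hshift : ∀ x : ℤ, (x : ZMod (2 * R + 1)) = ((x + (2 * R + 1) : ℤ) : ZMod (2 * R + 1)) :=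
    fun x => by
    rw [ZMod.intCast_eq_intCast_iff_dvd_sub]
    exact ⟨1, by push_cast; ring⟩
  have hshift' : ∀ x : ℤ, (x : ZMod (2 * R + 1)) = ((x - (2 * R + 1) : ℤ) : ZMod (2 * R + 1)) :=
    fun x => by rw [hshift (x - (2 * R + 1)), sub_add_cancel]
  have hsymm : ∀ i j, interpolate R f i j = interpolate R f j i := fun i j => by
    simp only [interpolate, add_comm i j, min_comm i j]
  have kmin : ∀ i s : ℤ, -min i (s - i) = max (-i) (i - s) := by omega
  have key : ∀ i s t : ℤ, |s - 2 * i| ≤ (R : ℤ) → |t - 2 * i| ≤ (R : ℤ) → s < t →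
      interpolate R f i (s - i) ≠ interpolate R f i (t - i) := fun i s t hs ht hst e => by
    have hs' := abs_le.1 hs
    have ht' := abs_le.1 ht
    simp only [interpolate, add_sub_cancel, kmin] at e
    have rs := hf.range i s hs
    have ls := hf.left i s hs
    have rt := hf.range i t ht
    have ij := hf.inj i s t hs ht
    generalize f s (max (-i) (i - s)) = x at *
    generalize f t (max (-i) (i - t)) = y at *
    split_ifs at e with h1 h2 h2 h4 h5 h6 h7 h8 <;> try omega
    · have := intCast_zmod_eq_imp e (by push_cast; omega) (by push_cast; omega)
      omega
    · rw [hshift' y] at e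
      have := intCast_zmod_eq_imp e (by push_cast; omega) (by push_cast; omega)
      omega
    · rcases swap_eq_cases e with ⟨ha, hb⟩ | ⟨ha, hb⟩ | ⟨-, -, h⟩
      · rw [hshift 0] at ha
        have := intCast_zmod_eq_imp ha (by push_cast; omega) (by push_cast; omega)
        rw [hshift' 3] at hb
        have := intCast_zmod_eq_imp hb (by push_cast; omega) (by push_cast; omega)
        omega
      · have := intCast_zmod_eq_imp ha (by push_cast; omega) (by push_cast; omega)
        omega
      · have := intCast_zmod_eq_imp h (by push_cast; omega) (by push_cast; omega)
        omega
    · have := intCast_zmod_eq_imp e (by push_cast; omega) (by push_cast; omega)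
      omega
    · rcases swap_eq_cases e with ⟨ha, hb⟩ | ⟨ha, hb⟩ | ⟨hn0, hn3, h⟩
      · have hx := intCast_zmod_eq_imp hb (by push_cast; omega) (by push_cast; omega)
        rw [hshift 0] at ha
        have := intCast_zmod_eq_imp ha (by push_cast; omega) (by push_cast; omega)
        omega
      · have hx := intCast_zmod_eq_imp hb (by push_cast; omega) (by push_cast; omega)
        rw [hshift 3] at ha
        have := intCast_zmod_eq_imp ha (by push_cast; omega) (by push_cast; omega)
        omega
      · have hx0 : x ≠ 0 := fun hx => hn0 (by rw [← h, hx])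
        have hx3 : x ≠ 3 := fun hx => hn3 (by rw [← h, hx])
        rw [hshift x] at h
        have := intCast_zmod_eq_imp h (by push_cast; omega) (by push_cast; omega)
        omega
    · have := intCast_zmod_eq_imp ((Equiv.swap _ _).injective e) (by push_cast; omega)
        (by push_cast; omega)
      omega
  have loop0 : ∀ i j : ℤ, i < j → j - i ≤ R →
      interpolate R f i i ≠ interpolate R f j j := fun i j hij hji e => by
    have abs1 : |i - j| ≤ (R : ℤ) := abs_le.2 ⟨by omega, by omega⟩
    have hloop := hf.loop
    have mid : ∀ k : ℤ, ¬ k + k < 0 → k + k < 4 → f (k + k) (-min k k) = f 0 0 ∧ k = 0 ∨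
        f (k + k) (-min k k) = f 2 (-1) ∧ k = 1 := fun k h1 h2 => by
      obtain rfl | rfl : k = 0 ∨ k = 1 := by omega
      · left; simp
      · right; simp
    simp only [interpolate] at e
    have hi := mid i
    have hj := mid j
    generalize f (i + i) (-min i i) = x at *
    generalize f (j + j) (-min j j) = y at *
    generalize f 0 0 = x0 at *
    generalize f 2 (-1) = x1 at *
    split_ifs at e with h1 h2 h2 h4 h5 h6 h7 h8 <;> try omega
    · exact hij.ne (std.loop i j abs1 e)
    · obtain rfl | rfl : y = 2 * 0 ∨ y = 2 * 1 := by omega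
      all_goals
        rw [← two_mul] at e
        have := intCast_zmod_eq_imp (two_mul_cancel e) (by push_cast; omega) (by push_cast; omega)
        omega
    · rcases swap_eq_cases e with ⟨ha, hb⟩ | ⟨ha, hb⟩ | ⟨-, -, h⟩
      · have := intCast_zmod_eq_imp ha (by push_cast; omega) (by push_cast; omega)
        omega
      · have := intCast_zmod_eq_imp ha (by push_cast; omega) (by push_cast; omega)
        omega
      · exact hij.ne (std.loop i j abs1 h)
    · have := intCast_zmod_eq_imp e (by push_cast; omega) (by push_cast; omega)
      omega
    · rcases swap_eq_cases e with ⟨ha, hb⟩ | ⟨ha, hb⟩ | ⟨hn0, hn3, h⟩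
      · have := intCast_zmod_eq_imp hb (by push_cast; omega) (by push_cast; omega)
        omega
      · rw [hshift 3, ← two_mul, show (3 + (2 * R + 1) : ℤ) = 2 * (R + 2) by ring] at ha
        have := intCast_zmod_eq_imp (two_mul_cancel ha) (by push_cast; omega) (by push_cast; omega)
        omega
      · obtain rfl | rfl : x = 0 ∨ x = 2 * 1 := by omega
        · exact hn0 h.symm
        · rw [← two_mul] at h
          have := intCast_zmod_eq_imp (two_mul_cancel h) (by push_cast; omega)
            (by push_cast; omega)
          omega
    · exact hij.ne (std.loop i j abs1 ((Equiv.swap _ _).injective e))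
  refine ⟨hsymm, fun i j k hj hk e => ?_, fun i j hij e => ?_⟩
  · by_contra hne
    have hj' : |i + j - 2 * i| ≤ (R : ℤ) := by convert hj using 2; ring
    have hk' : |i + k - 2 * i| ≤ (R : ℤ) := by convert hk using 2; ring
    rcases lt_or_gt_of_ne hne with h | h
    · exact key i (i + j) (i + k) hj' hk' (by omega) (by simpa using e)
    · exact key i (i + k) (i + j) hk' hj' (by omega) (by simpa using e.symm)
  · rw [abs_le] at hij
    by_contra hne
    rcases lt_or_gt_of_ne hne with h | h
    · exact loop0 i j h (by omega) e
    · exact loop0 j i h (by omega) e.symm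

theorem isInterpolation_of_emod_eq_zero {R : ℕ} {h : ℤ} (hR : (R : ℤ) = 2 * h + 1) (hh : 1 ≤ h)
    (h3 : h % 3 = 0) :
    IsInterpolation R fun s k =>
      if s = 0 then if k % 3 = 0 then 0 else 1
      else if s = 1 then if k = h then 1 else 3
      else if s = 2 then 2
      else if k % 3 = 0 then 1 else 0 := by
  constructor
  · intro i s hs h0 h4
    rw [abs_le] at hs
    obtain rfl | rfl | rfl | rfl : s = 0 ∨ s = 1 ∨ s = 2 ∨ s = 3 := by omega
    all_goals omega
  · intro i s hs h0 h4
    rw [abs_le] at hs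
    obtain rfl | rfl | rfl | rfl : s = 0 ∨ s = 1 ∨ s = 2 ∨ s = 3 := by omega
    all_goals omega
  · intro i s t hs ht h0 hst h4
    rw [abs_le] at hs ht
    obtain ⟨rfl, rfl⟩ | ⟨rfl, rfl⟩ | ⟨rfl, rfl⟩ | ⟨rfl, rfl⟩ | ⟨rfl, rfl⟩ | ⟨rfl, rfl⟩ :
      s = 0 ∧ t = 1 ∨ s = 0 ∧ t = 2 ∨ s = 0 ∧ t = 3 ∨ s = 1 ∧ t = 2 ∨ s = 1 ∧ t = 3 ∨
        s = 2 ∧ t = 3 := by omega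
    all_goals omega
  · norm_num

theorem isInterpolation_of_emod_eq_two {R : ℕ} {h : ℤ} (hR : (R : ℤ) = 2 * h + 1)
    (h3 : h % 3 = 2) :
    IsInterpolation R fun s k =>
      if s = 0 then if k = 0 then 2 else if k % 3 = 2 then 0 else 1
      else if s = 1 then if k = h then 1 else 3
      else if s = 2 then if k = -1 then 0 else if k = 0 then 1 else 2
      else if k = -1 then 2 else if k % 3 = 2 then 1 else 0 := by
  constructor
  · intro i s hs h0 h4
    rw [abs_le] at hs
    obtain rfl | rfl | rfl | rfl : s = 0 ∨ s = 1 ∨ s = 2 ∨ s = 3 := by omega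
    all_goals omega
  · intro i s hs h0 h4
    rw [abs_le] at hs
    obtain rfl | rfl | rfl | rfl : s = 0 ∨ s = 1 ∨ s = 2 ∨ s = 3 := by omega
    all_goals omega
  · intro i s t hs ht h0 hst h4
    rw [abs_le] at hs ht
    obtain ⟨rfl, rfl⟩ | ⟨rfl, rfl⟩ | ⟨rfl, rfl⟩ | ⟨rfl, rfl⟩ | ⟨rfl, rfl⟩ | ⟨rfl, rfl⟩ :
      s = 0 ∧ t = 1 ∨ s = 0 ∧ t = 2 ∨ s = 0 ∧ t = 3 ∨ s = 1 ∧ t = 2 ∨ s = 1 ∧ t = 3 ∨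
        s = 2 ∧ t = 3 := by omega
    all_goals omega
  · norm_num

theorem isInterpolation_of_emod_eq_one {R : ℕ} {h : ℤ} (hR : (R : ℤ) = 2 * h + 1) (hh : 2 ≤ h)
    (h3 : h % 3 = 1) :
    IsInterpolation R fun s k =>
      if s = 0 then if k = 0 then 2 else if k = 1 then 3 else if k % 3 = 1 then 0 else 1
      else if s = 1 then if k = 0 then 1 else if k = 1 then 0 else if k = h then 1 else 3
      else if s = 2 then if k = -1 then 0 else if k = 0 then 3 else 2
      else if k = -1 then 2 else if k % 3 = 1 then 1 else 0 := by
  constructor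
  · intro i s hs h0 h4
    rw [abs_le] at hs
    obtain rfl | rfl | rfl | rfl : s = 0 ∨ s = 1 ∨ s = 2 ∨ s = 3 := by omega
    all_goals omega
  · intro i s hs h0 h4
    rw [abs_le] at hs
    obtain rfl | rfl | rfl | rfl : s = 0 ∨ s = 1 ∨ s = 2 ∨ s = 3 := by omega
    all_goals omega
  · intro i s t hs ht h0 hst h4
    rw [abs_le] at hs ht
    obtain ⟨rfl, rfl⟩ | ⟨rfl, rfl⟩ | ⟨rfl, rfl⟩ | ⟨rfl, rfl⟩ | ⟨rfl, rfl⟩ | ⟨rfl, rfl⟩ :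
      s = 0 ∧ t = 1 ∨ s = 0 ∧ t = 2 ∨ s = 0 ∧ t = 3 ∨ s = 1 ∧ t = 2 ∨ s = 1 ∧ t = 3 ∨
        s = 2 ∧ t = 3 := by omega
    all_goals omega
  · norm_num

theorem isInterpolation_of_eq_one {R : ℕ} {h : ℤ} (hR : (R : ℤ) = 2 * h + 1) (hh : h = 1) :
    IsInterpolation R fun s k =>
      if s = 0 then if k = 0 then 2 else 1
      else if s = 1 then if k = 0 then 3 else 0
      else if s = 2 then if k = 0 then 1 else 0
      else if k = 0 then 0 else 2 := by
  constructor
  · intro i s hs h0 h4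
    rw [abs_le] at hs
    obtain rfl | rfl | rfl | rfl : s = 0 ∨ s = 1 ∨ s = 2 ∨ s = 3 := by omega
    all_goals omega
  · intro i s hs h0 h4
    rw [abs_le] at hs
    obtain rfl | rfl | rfl | rfl : s = 0 ∨ s = 1 ∨ s = 2 ∨ s = 3 := by omega
    all_goals omega
  · intro i s t hs ht h0 hst h4
    rw [abs_le] at hs ht
    obtain ⟨rfl, rfl⟩ | ⟨rfl, rfl⟩ | ⟨rfl, rfl⟩ | ⟨rfl, rfl⟩ | ⟨rfl, rfl⟩ | ⟨rfl, rfl⟩ :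
      s = 0 ∧ t = 1 ∨ s = 0 ∧ t = 2 ∨ s = 0 ∧ t = 3 ∨ s = 1 ∧ t = 2 ∨ s = 1 ∧ t = 3 ∨
        s = 2 ∧ t = 3 := by omega
    all_goals omega
  · norm_num

theorem add_swap {A : Type*} [AddGroup A] [DecidableEq A] (c a b x : A) :
    c + Equiv.swap a b x = Equiv.swap (c + a) (c + b) (c + x) := by
  simp only [Equiv.swap_apply_def, add_right_inj]
  split_ifs <;> rfl

/-- A strip coloring that is the coloring by sums on the left of the origin and has two colors
exchanged on the right yields a transition. -/
theorem isTransition_of_swap {R L : ℕ} {w : ℤ} {a d : ZMod (2 * R + 1)}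
    {c : ℤ → ℤ → ZMod (2 * R + 1)} (hc : IsStripColoring R c)
    (hl : ∀ i j, i + j < 0 → c i j = ((i + j : ℤ) : ZMod (2 * R + 1)))
    (hr : ∀ i j, w ≤ i + j → c i j = Equiv.swap a (a + d) ((i + j : ℤ) : ZMod (2 * R + 1)))
    (hw : 2 * R + w ≤ 2 * L) (hd : (2 * L : ZMod (2 * R + 1)) = d) :
    IsTransition R L (swapShift (2 * R + a) d) := by
  refine ⟨_, (hc.translate (-R)).comp (add_right_injective (2 * R : ZMod (2 * R + 1))),
    fun i j h => ?_, fun i j h => ?_⟩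
  · rw [hl _ _ (by omega)]
    push_cast
    ring
  · rw [hr _ _ (by omega)]
    have e : (2 * R + ((i + L + -R + (j + L + -R) : ℤ) : ZMod (2 * R + 1)) : ZMod (2 * R + 1)) =
        d + ((i + j : ℤ) : ZMod (2 * R + 1)) := by
      rw [← hd]
      push_cast
      ring
    rw [add_swap, e, ← add_assoc]
    rfl

theorem two_mul_add_one_eq_zero (R : ℕ) : (2 * R + 1 : ZMod (2 * R + 1)) = 0 := by
  exact_mod_cast ZMod.natCast_self (2 * R + 1)

theorem exists_isTransition_of_even {R : ℕ} (hR : Even R) :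
    ∃ a, IsTransition R (R + 1) (swapShift a 1) := by
  have h0 := two_mul_add_one_eq_zero R
  refine ⟨_, isTransition_of_swap (w := 0) (a := ((-R - 2 : ℤ) : ZMod (2 * R + 1)))
    (isStripColoring_cut hR) (fun i j h => if_pos h) (fun i j h => ?_) (by push_cast; omega) ?_⟩
  · rw [if_neg (by omega), show ((-R - 1 : ℤ) : ZMod (2 * R + 1)) =
      ((-R - 2 : ℤ) : ZMod (2 * R + 1)) + 1 by push_cast; ring]
  · push_cast
    linear_combination h0

theorem exists_isInterpolation {R : ℕ} (hR : Odd R) (h3 : 3 ≤ R) :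
    ∃ f, IsInterpolation R f := by
  obtain ⟨h, hh⟩ := hR
  have hR : (R : ℤ) = 2 * (h : ℤ) + 1 := by exact_mod_cast hh
  have : (h : ℤ) % 3 = 0 ∨ (h : ℤ) % 3 = 2 ∨ (h : ℤ) % 3 = 1 ∧ (2 : ℤ) ≤ h ∨ (h : ℤ) = 1 := by
    omega
  rcases this with h' | h' | ⟨h', h2⟩ | h'
  · exact ⟨_, isInterpolation_of_emod_eq_zero hR (by omega) h'⟩
  · exact ⟨_, isInterpolation_of_emod_eq_two hR h'⟩
  · exact ⟨_, isInterpolation_of_emod_eq_one hR h2 h'⟩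
  · exact ⟨_, isInterpolation_of_eq_one hR h'⟩

theorem exists_isTransition_of_odd {R : ℕ} (hR : Odd R) (h3 : 3 ≤ R) :
    ∃ a, IsTransition R (R + 2) (swapShift a 3) := by
  have h0 := two_mul_add_one_eq_zero R
  obtain ⟨f, hf⟩ := exists_isInterpolation hR h3
  refine ⟨_, isTransition_of_swap (w := 4) (a := ((0 : ℤ) : ZMod (2 * R + 1)))
    (isStripColoring_interpolate h3 hf) (fun i j h => if_pos h) (fun i j h => ?_)
    (by push_cast; omega) ?_⟩
  · rw [interpolate, if_neg (by omega), if_neg (by omega)]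
    norm_num
  · push_cast
    linear_combination h0

theorem IsTransition.one_of_gcd_dvd {R p n : ℕ} (hp : IsTransition R p 1)
    (hdvd : p.gcd (2 * R + 1) ∣ n) (hle : p.pred * (2 * R) ≤ n) : IsTransition R n 1 := by
  obtain ⟨x, y, rfl⟩ := Nat.exists_add_mul_eq_of_gcd_dvd_of_mul_pred_le p (2 * R + 1) n hdvd hle
  simpa using (hp.mul_one x).mul (IsTransition.one_period.mul_one y)

theorem IsTransition.one_of_coprime {R L d n : ℕ} {a : ZMod (2 * R + 1)} (hR : 1 ≤ R)
    (h : IsTransition R L (swapShift a (d : ZMod (2 * R + 1)))) (hd : (2 * R + 1).Coprime d)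
    (hL : L.Coprime (2 * R + 1)) (hle : (2 * R * L - 1) * (2 * R) ≤ n) : IsTransition R n 1 := by
  have hord : addOrderOf (d : ZMod (2 * R + 1)) = 2 * R + 1 := by
    rw [ZMod.addOrderOf_coe _ (by omega), hd.gcd_eq_one, Nat.div_one]
  have htop : AddSubgroup.zmultiples (d : ZMod (2 * R + 1)) = ⊤ := by
    apply AddSubgroup.eq_top_of_card_eq
    rw [Nat.card_zmultiples, hord, Nat.card_zmod]
  have hone : swapShift a (d : ZMod (2 * R + 1)) ^ (2 * R) = 1 :=
    swapShift_pow_eq_one hord (by omega) htop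
  have := h.pow (2 * R)
  rw [hone] at this
  refine this.one_of_gcd_dvd ?_ hle
  rw [Nat.Coprime.gcd_eq_one]
  · exact one_dvd _
  · exact Nat.Coprime.mul_left (by simp) hL

theorem mem_zmultiples_three_iff {N : ℕ} [NeZero N] (h : 3 ∣ N) (x : ZMod N) :
    x ∈ AddSubgroup.zmultiples (3 : ZMod N) ↔ ZMod.castHom h (ZMod 3) x = 0 := by
  constructor
  · intro hx
    obtain ⟨k, rfl⟩ := AddSubgroup.mem_zmultiples_iff.1 hx
    have : (3 : ZMod 3) = 0 := rfl
    rw [zsmul_eq_mul, map_mul, map_ofNat, this, mul_zero]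
  · intro hx
    rw [← ZMod.natCast_zmod_val x, map_natCast, ZMod.natCast_eq_zero_iff] at hx
    obtain ⟨k, hk⟩ := hx
    rw [← ZMod.natCast_zmod_val x, hk]
    exact AddSubgroup.mem_zmultiples_iff.2
      ⟨k, by push_cast; rw [natCast_zsmul, nsmul_eq_mul, mul_comm]⟩

theorem IsTransition.one_of_three_dvd {R m n : ℕ} {a : ZMod (2 * R + 1)} (hm : 2 ≤ m)
    (h : IsTransition R (R + 2) (swapShift a 3)) (hRm : 2 * R + 1 = 3 * m) (hn : 3 ∣ n)
    (hle : (3 * ((m - 1) * (R + 2)) + 3 * (2 * R + 1) + 2) * (2 * R) ≤ n) :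
    IsTransition R n 1 := by
  have h0 := two_mul_add_one_eq_zero R
  have hord : addOrderOf (3 : ZMod (2 * R + 1)) = m := by
    have := ZMod.addOrderOf_coe (n := 2 * R + 1) 3 (by omega)
    rw [show (2 * R + 1).gcd 3 = 3 from Nat.gcd_eq_right ⟨m, hRm⟩] at this
    exact_mod_cast this.trans (by omega)
  have h3N : 3 ∣ 2 * R + 1 := ⟨m, hRm⟩
  set φ := ZMod.castHom h3N (ZMod 3) with hφ
  set u := swapShift a (3 : ZMod (2 * R + 1)) ^ (m - 1) with hu
  have hu1 : ∀ x, φ x = φ a → u x = x := fun x hx =>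
    swapShift_pow_apply_mem hord hm (by rw [mem_zmultiples_three_iff h3N]; simp [← hφ, hx])
  have hu2 : ∀ x, φ x ≠ φ a → u x = x - 3 := fun x hx => by
    rw [hu, swapShift_pow_apply_notMem
      (by rw [mem_zmultiples_three_iff h3N, ← hφ, map_sub, sub_eq_zero]; exact hx)]
    have := addOrderOf_nsmul_eq_zero (3 : ZMod (2 * R + 1))
    obtain ⟨k, rfl⟩ : ∃ k, m = k + 1 := ⟨m - 1, by omega⟩
    rw [hord, succ_nsmul] at this
    rw [Nat.add_sub_cancel, eq_neg_of_add_eq_zero_left this, sub_eq_add_neg]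
  have tu : IsTransition R ((m - 1) * (R + 2)) u := h.pow (m - 1)
  have t1 := ((IsTransition.addLeft (R := R) R).mul tu).mul (IsTransition.addLeft (R + 1))
  have t2 := ((IsTransition.addLeft (R := R) (R + 1)).mul tu).mul (IsTransition.addLeft R)
  have key := ((tu.mul t1).mul t2).mul (IsTransition.addLeft (2 * R + 1 + 3))
  have hone : u * (Equiv.addLeft (2 * R : ZMod (2 * R + 1)) * u *
        Equiv.addLeft (2 * (R + 1 : ℕ) : ZMod (2 * R + 1))) *
      (Equiv.addLeft (2 * (R + 1 : ℕ) : ZMod (2 * R + 1)) * u *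
        Equiv.addLeft (2 * R : ZMod (2 * R + 1))) *
      Equiv.addLeft (2 * (2 * R + 1 + 3 : ℕ) : ZMod (2 * R + 1)) = 1 := by
    have e1 : (2 * R : ZMod (2 * R + 1)) = -1 := by linear_combination h0
    have e2 : (2 * (R + 1 : ℕ) : ZMod (2 * R + 1)) = 1 := by push_cast; linear_combination h0
    have e3 : (2 * (2 * R + 1 + 3 : ℕ) : ZMod (2 * R + 1)) = 6 := by
      push_cast; linear_combination 2 * h0
    ext1 x
    simp only [e1, e2, e3, Equiv.Perm.mul_apply, Equiv.coe_addLeft, Equiv.Perm.one_apply]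
    obtain ⟨t, ht⟩ : ∃ t, φ x = φ a + t := ⟨φ x - φ a, by ring⟩
    have hφc : ∀ c : ℤ, φ (x + c) = φ a + (t + c) := fun c => by
      rw [map_add, map_intCast, ht, add_assoc]
    have fix : ∀ c : ℤ, t + c = 0 → u (x + c) = x + c := fun c hc =>
      hu1 _ (by rw [hφc, hc, add_zero])
    have move : ∀ c : ℤ, t + c ≠ 0 → u (x + c) = x + (c - 3 : ℤ) := fun c hc => by
      rw [hu2 _ (by rw [hφc]; simpa using hc)]
      push_cast
      ring
    have s5 : -1 + (6 + x) = x + (5 : ℤ) := by push_cast; ring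
    have up : ∀ c : ℤ, 1 + (1 + (x + c)) = x + (c + 2 : ℤ) := fun c => by push_cast; ring
    have down : ∀ c : ℤ, -1 + (x + c) = x + (c - 1 : ℤ) := fun c => by push_cast; ring
    have t0 : t = 0 ∨ t = 1 ∨ t = -1 := by
      clear fix move hφc ht
      revert t
      decide
    rcases t0 with rfl | rfl | rfl
    · rw [s5, move 5 (by decide), up, move _ (by decide), down, fix _ (by decide)]
      simp
    · rw [s5, fix 5 (by decide), up, move _ (by decide), down, move _ (by decide)]
      simp
    · rw [s5, move 5 (by decide), up, fix _ (by decide), down, move _ (by decide)]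
      simp
  rw [hone] at key
  refine key.one_of_gcd_dvd ?_ (le_trans (Nat.mul_le_mul_right _ ?_) hle)
  · refine Nat.dvd_trans ?_ hn
    set q := (m - 1) * (R + 2) + (R + (m - 1) * (R + 2) + (R + 1)) +
      (R + 1 + (m - 1) * (R + 2) + R) + (2 * R + 1 + 3) with hq
    obtain ⟨y, hy⟩ := Nat.gcd_dvd_left q (2 * R + 1)
    obtain ⟨z, hz⟩ := Nat.gcd_dvd_right q (2 * R + 1)
    rw [← Int.natCast_dvd_natCast]
    refine ⟨(2 * (R + 2) + 3) * z - 2 * y, ?_⟩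
    zify [show 1 ≤ m by omega] at hq hy hz hRm
    rw [hq] at hy
    push_cast
    linear_combination (2 * (R + 2) + 3 : ℤ) * hz - 2 * hy - 2 * (R + 2 : ℤ) * hRm
  · rw [Nat.pred_eq_sub_one]
    generalize (m - 1) * (R + 2) = z
    omega

theorem isTransition_one {R n : ℕ} (hR : 1 ≤ R)
    (hlen : (R + 2) * (R + 1) * (R ^ 2 + 5 * R + 2) ≤ 2 * (n + 2 * R))
    (hmod : ¬ R ≡ 1 [MOD 6] ∨ n ≡ 0 [MOD 3]) : IsTransition R n 1 := by
  have hn : 4 * R ^ 2 * (R + 2) ≤ n + 2 * R := by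
    have h3 : 8 * R ^ 2 ≤ (R + 1) * (R ^ 2 + 5 * R + 2) := by
      zify
      nlinarith [mul_nonneg (Int.natCast_nonneg R) (sq_nonneg ((R : ℤ) - 1))]
    nlinarith
  rcases Nat.even_or_odd R with he | ho
  · obtain ⟨a, ha⟩ := exists_isTransition_of_even he
    refine IsTransition.one_of_coprime (L := R + 1) (d := 1) hR (a := a) (by simpa using ha)
      (by simp) ?_ ?_
    · rw [show 2 * R + 1 = R + (R + 1) by ring]
      simp
    · obtain ⟨x, rfl⟩ : ∃ x, R = x + 1 := ⟨R - 1, by omega⟩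
      zify [show 1 ≤ 2 * (x + 1) * (x + 1 + 1) by nlinarith] at hn ⊢
      nlinarith [sq_nonneg (x : ℤ)]
  by_cases h1 : R = 1
  · subst h1
    have : 3 ∣ n := Nat.modEq_zero_iff_dvd.1 (hmod.resolve_left (by decide))
    obtain ⟨k, rfl⟩ := this
    rw [mul_comm]
    exact IsTransition.one_period.mul_one k
  have h3 : 3 ≤ R := by
    obtain ⟨r, rfl⟩ := ho
    omega
  obtain ⟨a, ha⟩ := exists_isTransition_of_odd ho h3
  by_cases hdvd : 3 ∣ 2 * R + 1
  · obtain ⟨m, hm⟩ := hdvd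
    have h7 : R ≡ 1 [MOD 6] := by
      obtain ⟨r, rfl⟩ := ho
      unfold Nat.ModEq
      omega
    have hn3 : 3 ∣ n := Nat.modEq_zero_iff_dvd.1 (hmod.resolve_left (not_not.2 h7))
    refine IsTransition.one_of_three_dvd (by omega) ha hm hn3 ?_
    have h7' : 7 ≤ R := by
      unfold Nat.ModEq at h7
      omega
    obtain ⟨x, rfl⟩ : ∃ x, R = x + 7 := ⟨R - 7, by omega⟩
    have e : 3 * ((m - 1) * (x + 7 + 2)) = (2 * (x + 7) - 2) * (x + 7 + 2) := by
      rw [← mul_assoc]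
      congr 1
      omega
    rw [e, show 2 * (x + 7) - 2 = 2 * x + 12 by omega]
    nlinarith [Nat.zero_le (x ^ 2), Nat.zero_le (x ^ 3), Nat.zero_le (x ^ 4)]
  · refine IsTransition.one_of_coprime (L := R + 2) (d := 3) hR (a := a) (by exact_mod_cast ha)
      ?_ ?_ ?_
    · exact ((Nat.Prime.coprime_iff_not_dvd Nat.prime_three).2 hdvd).symm
    · have : Nat.gcd (R + 2) (2 * R + 1) ∣ 3 := by
        have h1 := (Nat.gcd_dvd_left (R + 2) (2 * R + 1)).mul_left 2
        have h2 := Nat.gcd_dvd_right (R + 2) (2 * R + 1)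
        have := Nat.dvd_sub h1 h2
        rwa [show 2 * (R + 2) - (2 * R + 1) = 3 by omega] at this
      rcases (Nat.dvd_prime Nat.prime_three).1 this with h | h
      · exact h
      · exact absurd (h ▸ Nat.gcd_dvd_right (R + 2) (2 * R + 1)) hdvd
    · obtain ⟨x, rfl⟩ : ∃ x, R = x + 1 := ⟨R - 1, by omega⟩
      zify [show 1 ≤ 2 * (x + 1) * (x + 1 + 2) by nlinarith] at hn ⊢
      nlinarith

theorem length_bound {R n : ℕ}
    (hn : (R + 2) * 2 ^ (1 + Nat.log 2 R) * (R + (R + 2) * 2 ^ Nat.log 2 R) ≤ n + 2 * R) :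
    (R + 2) * (R + 1) * (R ^ 2 + 5 * R + 2) ≤ 2 * (n + 2 * R) := by
  have h := Nat.lt_pow_succ_log_self one_lt_two R
  rw [pow_succ] at h
  rw [pow_add, pow_one] at hn
  generalize 2 ^ Nat.log 2 R = P at *
  have hP : R + 1 ≤ 2 * P := by omega
  have h2 : (R + 1) * (2 * R + (R + 2) * (R + 1)) ≤ (2 * P) * (2 * R + (R + 2) * (2 * P)) := by
    gcongr
  nlinarith

/-! ### From periodic strip colorings to the circulant graph -/

section Circulant

variable {R n : ℕ}

theorem circulant_adj_iff {u v : ZMod n} (hn : 2 * R < n) :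
    (circulant n (Set.Icc 1 R)).Adj u v ↔
      ∃ d : ℤ, d ≠ 0 ∧ |d| ≤ (R : ℤ) ∧ v = u + d := by
  rw [SimpleGraph.circulantGraph_adj]
  constructor
  · rintro ⟨hne, ⟨d, ⟨h1, h2⟩, hd⟩ | ⟨d, ⟨h1, h2⟩, hd⟩⟩
    · refine ⟨-d, by omega, abs_le.2 ⟨by omega, by omega⟩, ?_⟩
      push_cast
      dsimp only at hd
      rw [hd]; ring
    · refine ⟨d, by omega, abs_le.2 ⟨by omega, by omega⟩, ?_⟩
      push_cast
      dsimp only at hd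
      rw [hd]; ring
  · rintro ⟨d, h0, hd, rfl⟩
    rw [abs_le] at hd
    refine ⟨fun h => h0 ?_, ?_⟩
    · have : ((d : ℤ) : ZMod n) = ((0 : ℤ) : ZMod n) := by
        simpa using h.symm
      exact intCast_zmod_eq_imp this (by omega) (by omega)
    · rcases lt_or_gt_of_ne h0 with h | h
      · left
        refine ⟨d.natAbs, ⟨by omega, by omega⟩, ?_⟩
        have : ((d.natAbs : ℤ) : ZMod n) = ((-d : ℤ) : ZMod n) := by congr 1; omega
        push_cast at this
        simpa using this
      · right
        refine ⟨d.natAbs, ⟨by omega, by omega⟩, ?_⟩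
        have : ((d.natAbs : ℤ) : ZMod n) = ((d : ℤ) : ZMod n) := by congr 1; omega
        simpa using this

theorem circulant_degree [NeZero n] (hn : 2 * R < n) (u : ZMod n)
    [Fintype ((circulant n (Set.Icc 1 R)).neighborSet u)] :
    (circulant n (Set.Icc 1 R)).degree u = 2 * R := by
  classical
  have : (circulant n (Set.Icc 1 R)).neighborFinset u =
      ((Finset.Icc (-R : ℤ) R).erase 0).image fun d : ℤ => u + d := by
    ext v
    rw [SimpleGraph.mem_neighborFinset, circulant_adj_iff hn]
    simp only [Finset.mem_image, Finset.mem_erase, Finset.mem_Icc, abs_le]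
    constructor
    · rintro ⟨d, h0, h, rfl⟩
      exact ⟨d, ⟨h0, h⟩, rfl⟩
    · rintro ⟨d, ⟨h0, h⟩, rfl⟩
      exact ⟨d, h0, h, rfl⟩
  rw [SimpleGraph.degree, this, Finset.card_image_of_injOn]
  · rw [Finset.card_erase_of_mem (by simp), Int.card_Icc]
    omega
  · intro x hx y hy hxy
    simp only [Finset.coe_erase, Finset.coe_Icc, Set.mem_sdiff, Set.mem_Icc] at hx hy
    exact intCast_zmod_eq_imp (add_left_cancel hxy) (by omega) (by omega)

/-- The color of a directed edge of the circulant graph. -/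
def arcColor {C : Type*} (c : ℤ → ℤ → C) (u v : ZMod n) : C :=
  c u.val (u.val + (v - u).valMinAbs)

theorem arcColor_intCast {C : Type*} [NeZero n] {c : ℤ → ℤ → C}
    (hc : ∀ i j, c (i + n) (j + n) = c i j) (hn : 2 * R < n) (i d : ℤ) (hd : |d| ≤ (R : ℤ)) :
    arcColor c (i : ZMod n) (i + d : ZMod n) = c i (i + d) := by
  rw [abs_le] at hd
  have per : ∀ (k : ℕ) (i j : ℤ), c (i + n * k) (j + n * k) = c i j := fun k => by
    induction k with
    | zero => simp
    | succ k ih =>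
      intro i j
      rw [← ih i j, ← hc (i + n * k)]
      congr 1 <;> push_cast <;> ring
  have per' : ∀ (k : ℤ) (i j : ℤ), c (i + n * k) (j + n * k) = c i j := fun k i j => by
    obtain ⟨k, rfl | rfl⟩ := k.eq_nat_or_neg
    · exact per k i j
    · rw [← per k]
      congr 1 <;> ring
  have hd' : ((i + d : ZMod n) - i).valMinAbs = d := by
    rw [add_sub_cancel_left, ZMod.valMinAbs_spec]
    exact ⟨rfl, by constructor <;> omega⟩
  rw [arcColor, hd', ZMod.val_intCast, ← per' (-(i / n)), ← per' (-(i / n)) i]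
  have := Int.emod_add_mul_ediv i n
  rw [← per' (i / n)]
  congr 1 <;> linarith

theorem arcColor_comm {C : Type*} [NeZero n] {c : ℤ → ℤ → C} (hs : IsStripColoring R c)
    (hc : ∀ i j, c (i + n) (j + n) = c i j) (hn : 2 * R < n) {u v : ZMod n}
    (h : (circulant n (Set.Icc 1 R)).Adj u v) : arcColor c u v = arcColor c v u := by
  obtain ⟨d, h0, hd, rfl⟩ := (circulant_adj_iff hn).1 h
  obtain ⟨i, rfl⟩ := ZMod.intCast_surjective u
  rw [arcColor_intCast hc hn i d hd, hs.symm]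
  have := arcColor_intCast hc hn (i + d) (-d) (by rwa [abs_neg])
  push_cast at this
  simpa using this.symm

/-- The edge coloring of the circulant graph given by a periodic coloring of pairs of integers. -/
noncomputable def edgeColor {C : Type*} (c : ℤ → ℤ → C)
    (e : (circulant n (Set.Icc 1 R)).edgeSet) : C :=
  arcColor c (Quot.out (e : Sym2 (ZMod n))).1 (Quot.out (e : Sym2 (ZMod n))).2

theorem edgeColor_eq {C : Type*} [NeZero n] {c : ℤ → ℤ → C} (hs : IsStripColoring R c)
    (hc : ∀ i j, c (i + n) (j + n) = c i j) (hn : 2 * R < n) {u v : ZMod n}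
    (e : (circulant n (Set.Icc 1 R)).edgeSet) (he : (e : Sym2 (ZMod n)) = s(u, v)) :
    edgeColor c e = arcColor c u v := by
  have h : (circulant n (Set.Icc 1 R)).Adj u v := by
    rw [← SimpleGraph.mem_edgeSet, ← he]
    exact e.2
  have ho : s((Quot.out (e : Sym2 (ZMod n))).1, (Quot.out (e : Sym2 (ZMod n))).2) = s(u, v) := by
    rw [← he]
    exact Quot.out_eq _
  rw [edgeColor]
  rcases Sym2.eq_iff.1 ho with ⟨h1, h2⟩ | ⟨h1, h2⟩
  · rw [h1, h2]
  · rw [h1, h2, arcColor_comm hs hc hn h]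

/-- Every edge at the vertex `i` goes to `i + d` for some `d` and has the color of `i, i + d`. -/
theorem exists_edgeColor_eq {C : Type*} [NeZero n] {c : ℤ → ℤ → C} (hs : IsStripColoring R c)
    (hc : ∀ i j, c (i + n) (j + n) = c i j) (hn : 2 * R < n) (i : ℤ)
    (e : (circulant n (Set.Icc 1 R)).edgeSet) (he : (i : ZMod n) ∈ (e : Sym2 (ZMod n))) :
    ∃ d : ℤ, d ≠ 0 ∧ |d| ≤ (R : ℤ) ∧ (e : Sym2 (ZMod n)) = s((i : ZMod n), (i + d : ZMod n)) ∧
      edgeColor c e = c i (i + d) := by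
  obtain ⟨v, hv⟩ := Sym2.mem_iff_exists.1 he
  have h : (circulant n (Set.Icc 1 R)).Adj i v := by
    rw [← SimpleGraph.mem_edgeSet, ← hv]
    exact e.2
  obtain ⟨d, h0, hd, rfl⟩ := (circulant_adj_iff hn).1 h
  exact ⟨d, h0, hd, hv, by rw [edgeColor_eq hs hc hn e hv, arcColor_intCast hc hn i d hd]⟩

theorem incidentColors_edgeColor [NeZero n] {c : ℤ → ℤ → ZMod (2 * R + 1)}
    (hs : IsStripColoring R c) (hc : ∀ i j, c (i + n) (j + n) = c i j) (hn : 2 * R < n) (i : ℤ) :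
    incidentColors (edgeColor c : (circulant n (Set.Icc 1 R)).edgeSet → _) (i : ZMod n) =
      {c i i}ᶜ := by
  have surj : ∀ a, ∃ d ∈ Finset.Icc (-R : ℤ) R, c i (i + d) = a := by
    have := Finset.surj_on_of_inj_on_of_card_le (s := Finset.Icc (-R : ℤ) R)
      (t := (Finset.univ : Finset (ZMod (2 * R + 1)))) (fun d _ => c i (i + d)) (by simp)
      (fun d e hd he h => ?_) ?_
    · intro a
      obtain ⟨d, hd, h⟩ := this a (Finset.mem_univ a)
      exact ⟨d, hd, h.symm⟩
    · rw [Finset.mem_Icc] at hd he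
      simpa using hs.inj i (i + d) (i + e) (by simpa [abs_le] using hd)
        (by simpa [abs_le] using he) h
    · rw [Finset.card_univ, ZMod.card, Int.card_Icc]
      omega
  ext a
  simp only [incidentColors, Set.mem_ofPred_eq, Set.mem_compl_iff, Set.mem_singleton_iff]
  constructor
  · rintro ⟨e, he, rfl⟩ h
    obtain ⟨d, h0, hd, -, hcol⟩ := exists_edgeColor_eq hs hc hn i e he
    rw [hcol] at h
    have := hs.inj i (i + d) i (by simpa using hd) (by simp) h
    omega
  · intro ha
    obtain ⟨d, hd, rfl⟩ := surj a
    have h0 : d ≠ 0 := by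
      rintro rfl
      simp at ha
    have hd' : |d| ≤ (R : ℤ) := by simpa [abs_le] using hd
    refine ⟨⟨s((i : ZMod n), (i + d : ZMod n)), ?_⟩, Sym2.mem_mk_left _ _, ?_⟩
    · rw [SimpleGraph.mem_edgeSet, circulant_adj_iff hn]
      exact ⟨d, h0, hd', rfl⟩
    · rw [edgeColor_eq hs hc hn _ rfl, arcColor_intCast hc hn i d hd']

theorem isAVDColoring_edgeColor [NeZero n] {c : ℤ → ℤ → ZMod (2 * R + 1)}
    (hs : IsStripColoring R c) (hc : ∀ i j, c (i + n) (j + n) = c i j) (hn : 2 * R < n) :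
    IsAVDColoring (edgeColor c : (circulant n (Set.Icc 1 R)).edgeSet → _) := by
  refine ⟨fun e f hef v he hf h => hef ?_, fun u v huv h => ?_⟩
  · obtain ⟨i, rfl⟩ := ZMod.intCast_surjective v
    obtain ⟨d, -, hd, hed, hcd⟩ := exists_edgeColor_eq hs hc hn i e he
    obtain ⟨d', -, hd', hed', hcd'⟩ := exists_edgeColor_eq hs hc hn i f hf
    rw [hcd, hcd'] at h
    have := hs.inj i (i + d) (i + d') (by simpa using hd) (by simpa using hd') h
    obtain rfl : d = d' := by omega
    exact Subtype.ext (hed.trans hed'.symm)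
  · obtain ⟨d, h0, hd, rfl⟩ := (circulant_adj_iff hn).1 huv
    obtain ⟨i, rfl⟩ := ZMod.intCast_surjective u
    rw [← Int.cast_add, incidentColors_edgeColor hs hc hn, incidentColors_edgeColor hs hc hn,
      compl_inj_iff, Set.singleton_eq_singleton_iff] at h
    have := hs.loop i (i + d) (by rw [abs_sub_comm]; simpa using hd) h
    omega

end Circulant

section LowerBound

variable {V : Type*} {G : SimpleGraph V} {k D : ℕ}

theorem le_ncard_incidentColors {c : G.edgeSet → Fin k} (hc : IsProperEdgeColoring c) (v : V)
    [Fintype (G.neighborSet v)] : G.degree v ≤ (incidentColors c v).ncard := by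
  rw [← SimpleGraph.card_neighborSet_eq_degree, ← Nat.card_eq_fintype_card,
    ← Nat.card_coe_set_eq]
  refine Nat.card_le_card_of_injective
    (fun w : G.neighborSet v => (⟨c ⟨s(v, w), w.2⟩, ⟨s(v, w), w.2⟩, Sym2.mem_mk_left _ _, rfl⟩ :
      incidentColors c v)) fun w w' h => ?_
  by_contra hne
  refine hc ⟨s(v, w), w.2⟩ ⟨s(v, w'), w'.2⟩ (fun h' => hne ?_) v (Sym2.mem_mk_left _ _)
    (Sym2.mem_mk_left _ _) (congrArg Subtype.val h)
  exact Subtype.ext (Sym2.congr_right.1 (congrArg Subtype.val h'))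

/-- In an adjacent vertex-distinguishing edge-coloring, two adjacent vertices of degree `D` cannot
both see all the colors, so that more than `D` colors are used. -/
theorem IsAVDColoring.lt_of_adj {c : G.edgeSet → Fin k} (hc : IsAVDColoring c) {u v : V}
    [Fintype (G.neighborSet u)] [Fintype (G.neighborSet v)] (huv : G.Adj u v)
    (hu : G.degree u = D) (hv : G.degree v = D) : D < k := by
  by_contra hlt
  have all : ∀ w : V, D ≤ (incidentColors c w).ncard → incidentColors c w = Set.univ :=
    fun w hw => Set.eq_of_subset_of_ncard_le (Set.subset_univ _) (by
      rw [Set.ncard_univ, Nat.card_fin]; omega)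
  refine hc.2 u v huv ?_
  rw [all u (hu ▸ le_ncard_incidentColors hc.1 u), all v (hv ▸ le_ncard_incidentColors hc.1 v)]

end LowerBound

theorem theorem1 (R n : ℕ) [NeZero n] [DecidableRel (circulant n (Set.Icc 1 R)).Adj]
    (hR : 1 ≤ R)
    (hn : (R + 2) * 2 ^ (1 + Nat.log 2 R) * (R + (R + 2) * 2 ^ Nat.log 2 R) ≤ n + 2 * R)
    (hmod : ¬ R ≡ 1 [MOD 6] ∨ n ≡ 0 [MOD 3]) :
    avdChromaticIndex (circulant n (Set.Icc 1 R)) = ((2 * R + 1 : ℕ) : ℕ∞) ∧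
      2 * R + 1 = (circulant n (Set.Icc 1 R)).maxDegree + 1 := by
  have hlen := length_bound hn
  have hn2 : 2 * R < n := by nlinarith
  have hdeg : ∀ u, (circulant n (Set.Icc 1 R)).degree u = 2 * R := fun u => circulant_degree hn2 u
  refine ⟨le_antisymm ?_ ?_, ?_⟩
  · obtain ⟨c, hs, hc⟩ := (isTransition_one hR hlen hmod).exists_periodic (by omega)
    exact iInf₂_le (2 * R + 1) ⟨edgeColor c, isAVDColoring_edgeColor hs hc hn2⟩
  · refine le_iInf₂ fun k ⟨c, hc⟩ => ?_
    have hadj : (circulant n (Set.Icc 1 R)).Adj 0 1 :=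
      (circulant_adj_iff hn2).2 ⟨1, one_ne_zero, by simpa using hR, by simp⟩
    exact_mod_cast hc.lt_of_adj hadj (hdeg 0) (hdeg 1)
  · have : (circulant n (Set.Icc 1 R)).IsRegularOfDegree (2 * R) := hdeg
    rw [this.maxDegree_eq]
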